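/- **Theorem 3.1.** Let $\mu$ be a finite positive Borel measure on the unit circle $\partial\mathbb{D}=\{z\in\mathbb{C}: |z|=1\}$ of the form $$d\mu(e^{i\theta}) = w(\theta)\,\frac{d\theta}{2\pi} + d\mu_{\mathrm s}(e^{i\theta}),$$ where $\mu_{\mathrm s}$ is a measure singular with respect to Lebesgue measure on $\partial\mathbb{D}$ and $w(\theta)>0$ for a.e. $\theta$. Let $\Phi_n$ be the monic orthogonal polynomials of $\mu$, let $\alpha_n$ ($n\ge 0$) be its Verblunsky coefficients, determined by $\Phi_{n+1}(z)=z\Phi_n(z)-\bar\alpha_n\Phi_n^*(z)$ with $\Phi_n^*(z)=z^n\,\overline{\Phi_n(1/\bar z)}$, and let $\rho_n=(1-|\alpha_n|^2)^{1/2}$. Then $\mu$ is regular: that is, with $E=\operatorname{supp}(\mu)$ and $C(E)$ the logarithmic capacity of $E$, $$\lim_{n\to\infty}(\rho_1\cdots\rho_n)^{1/n}=C(E).$$ Here $E=\partial\mathbb{D}$ and $C(\partial\mathbb{D})=1$, so that $$\lim_{n\to\infty}(\rho_1\cdots\rho_n)^{1/n}=1.$$ -/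

import Mathlib

open MeasureTheory Filter Topology Polynomial ComplexConjugate

noncomputable section

namespace OPUC

/-! Throughout, a measure on the unit circle is a finite Borel measure `μ` on `ℂ` with
`μ (sphere 0 1)ᶜ = 0`. -/

/-- The normalized Lebesgue measure `dθ / 2π` on the interval `(0, 2π]` of angles. -/
def angleMeasure : Measure ℝ :=
  (ENNReal.ofReal (2 * Real.pi))⁻¹ • volume.restrict (Set.Ioc 0 (2 * Real.pi))

/-- Normalized Lebesgue measure on the unit circle: the image of `dθ / 2π` under `θ ↦ e^{iθ}`. -/
def circleLebesgue : Measure ℂ := angleMeasure.map (circleMap 0 1)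

/-- The measure `w(θ) dθ / 2π` on the unit circle. -/
def acPart (w : ℝ → ℝ) : Measure ℂ :=
  (angleMeasure.withDensity fun θ => ENNReal.ofReal (w θ)).map (circleMap 0 1)

/-- The inner product of `L²(μ)` on polynomials, antilinear in the first variable. -/
def opInner (μ : Measure ℂ) (p q : ℂ[X]) : ℂ :=
  ∫ z, conj (p.eval z) * q.eval z ∂μ

/-- The monic orthogonal polynomials `Φ_n` of `μ`, by the Gram–Schmidt process applied to
`1, z, z², …`. -/
def monicOP (μ : Measure ℂ) : ℕ → ℂ[X]
  | n => X ^ n - ∑ j : Fin n,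
      C (opInner μ (monicOP μ j) (X ^ n) / opInner μ (monicOP μ j) (monicOP μ j)) * monicOP μ j
termination_by n => n
decreasing_by all_goals exact j.2

/-- The reversed polynomial `p^*(z) = z^n conj (p (1 / conj z))` of a polynomial `p` of degree
at most `n`. -/
def revPoly (n : ℕ) (p : ℂ[X]) : ℂ[X] := (p.map (starRingEnd ℂ)).reflect n

/-- The Verblunsky coefficients `α_n`: evaluating `Φ_{n+1} = z Φ_n - conj α_n Φ_n^*` at `0`
gives `conj α_n = - Φ_{n+1}(0)`. That this `α_n` does satisfy the recursion is
the theorem `szego_recursion` below. -/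
def verblunsky (μ : Measure ℂ) (n : ℕ) : ℂ := -conj ((monicOP μ (n + 1)).eval 0)

section recursion

theorem integrable_of_circle {μ : Measure ℂ} [IsFiniteMeasure μ]
    (hμ : μ (Metric.sphere (0 : ℂ) 1)ᶜ = 0) {f : ℂ → ℂ}
    (hf : Continuous f) : Integrable f μ := by
  have h : IntegrableOn f (Metric.sphere (0 : ℂ) 1) μ :=
    hf.continuousOn.integrableOn_compact (isCompact_sphere _ _)
  have hr : μ.restrict (Metric.sphere (0 : ℂ) 1) = μ :=
    Measure.restrict_eq_self_of_ae_mem (by rw [ae_iff]; exact hμ)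
  rwa [IntegrableOn, hr] at h

theorem integrable_op {μ : Measure ℂ} [IsFiniteMeasure μ]
    (hμ : μ (Metric.sphere (0 : ℂ) 1)ᶜ = 0) (p q : ℂ[X]) :
    Integrable (fun z => conj (p.eval z) * q.eval z) μ :=
  integrable_of_circle hμ (by
    exact (Complex.continuous_conj.comp p.continuous).mul q.continuous)

theorem opInner_sub_right {μ : Measure ℂ} [IsFiniteMeasure μ]
    (hμ : μ (Metric.sphere (0 : ℂ) 1)ᶜ = 0) (p q r : ℂ[X]) :
    opInner μ p (q - r) = opInner μ p q - opInner μ p r := by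
  simp only [opInner, eval_sub, mul_sub]
  exact integral_sub (integrable_op hμ p q) (integrable_op hμ p r)

theorem opInner_sum_right {μ : Measure ℂ} [IsFiniteMeasure μ]
    (hμ : μ (Metric.sphere (0 : ℂ) 1)ᶜ = 0) {ι : Type*} (s : Finset ι)
    (p : ℂ[X]) (q : ι → ℂ[X]) :
    opInner μ p (∑ i ∈ s, q i) = ∑ i ∈ s, opInner μ p (q i) := by
  simp only [opInner, eval_finsetSum, Finset.mul_sum]
  exact integral_finsetSum s fun i _ => integrable_op hμ p (q i)

theorem opInner_C_mul_right {μ : Measure ℂ} (p q : ℂ[X]) (a : ℂ) :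
    opInner μ p (C a * q) = a * opInner μ p q := by
  simp only [opInner, eval_mul, eval_C, ← integral_const_mul]
  congr 1; ext z; ring

theorem opInner_conj {μ : Measure ℂ} (p q : ℂ[X]) : conj (opInner μ p q) = opInner μ q p := by
  simp only [opInner]
  rw [← integral_conj]
  congr 1; ext z; simp [mul_comm]

theorem eq_zero_of_opInner_self {μ : Measure ℂ} [IsFiniteMeasure μ]
    (hμ : μ (Metric.sphere (0 : ℂ) 1)ᶜ = 0)
    (hinf : ∀ s : Finset ℂ, μ (s : Set ℂ)ᶜ ≠ 0) {p : ℂ[X]} (h : opInner μ p p = 0) : p = 0 := by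
  by_contra hp
  have e : (fun z => conj (p.eval z) * p.eval z) = fun z => ((‖p.eval z‖ ^ 2 : ℝ) : ℂ) := by
    ext z; rw [Complex.conj_mul']; norm_cast
  have hi := integrable_op hμ p p
  rw [opInner, e, integral_complex_ofReal] at h
  rw [e] at hi
  have hi' : Integrable (fun z => ‖p.eval z‖ ^ 2) μ := by
    refine hi.re.congr (Eventually.of_forall fun z => ?_)
    simp only [RCLike.re_to_complex, Complex.ofReal_re]
  have h0 := (integral_eq_zero_iff_of_nonneg (fun z => by positivity) hi').1
    (by exact_mod_cast h)
  apply hinf p.roots.toFinset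
  refine measure_mono_null ?_ (ae_iff.1 h0)
  intro z hz hz'
  apply hz
  simpa [hp] using hz'

theorem monicOP_eq (μ : Measure ℂ) (n : ℕ) : monicOP μ n = X ^ n - ∑ j ∈ Finset.range n,
    C (opInner μ (monicOP μ j) (X ^ n) / opInner μ (monicOP μ j) (monicOP μ j)) * monicOP μ j := by
  conv_lhs => rw [monicOP]
  rw [Finset.sum_range]

theorem degree_monicOP_sub_lt (μ : Measure ℂ) (n : ℕ) : (monicOP μ n - X ^ n).degree < (n : WithBot ℕ) := by
  induction n using Nat.strong_induction_on with
  | _ n ih =>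
    rw [monicOP_eq, sub_sub_cancel_left, degree_neg]
    refine (degree_sum_le _ _).trans_lt ((Finset.sup_lt_iff (WithBot.bot_lt_coe n)).2 ?_)
    intro j hj
    have hj' := Finset.mem_range.1 hj
    have hjn : (j : WithBot ℕ) < (n : WithBot ℕ) := by exact_mod_cast hj'
    rw [← smul_eq_C_mul]
    refine (degree_smul_le _ _).trans_lt ?_
    have h1 : monicOP μ j = (monicOP μ j - X ^ j) + X ^ j := by ring
    rw [h1]
    refine (degree_add_le _ _).trans_lt (max_lt ((ih j hj').trans hjn) ?_)
    rw [degree_X_pow]; exact hjn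

theorem degree_monicOP (μ : Measure ℂ) (n : ℕ) : (monicOP μ n).degree = n := by
  have h := degree_monicOP_sub_lt μ n
  rw [← degree_X_pow (R := ℂ) n] at h ⊢
  rw [show monicOP μ n = X ^ n + (monicOP μ n - X ^ n) by ring]
  exact degree_add_eq_left_of_degree_lt h

theorem opInner_monicOP {μ : Measure ℂ} [IsFiniteMeasure μ]
    (hμ : μ (Metric.sphere (0 : ℂ) 1)ᶜ = 0)
    (hinf : ∀ s : Finset ℂ, μ (s : Set ℂ)ᶜ ≠ 0) (n : ℕ) :
    ∀ k < n, opInner μ (monicOP μ k) (monicOP μ n) = 0 := by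
  induction n using Nat.strong_induction_on with
  | _ n ih =>
    intro k hk
    have hne : opInner μ (monicOP μ k) (monicOP μ k) ≠ 0 := fun h => by
      have := degree_monicOP μ k
      rw [eq_zero_of_opInner_self hμ hinf h] at this
      simp at this
    rw [monicOP_eq μ n, opInner_sub_right hμ, opInner_sum_right hμ,
      Finset.sum_eq_single_of_mem k (Finset.mem_range.2 hk), opInner_C_mul_right]
    · field_simp; simp
    · intro j hj hjk
      rcases lt_or_gt_of_ne hjk with h | h
      · rw [opInner_C_mul_right, ← opInner_conj (monicOP μ j) (monicOP μ k), ih k hk j h]; simp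
      · rw [opInner_C_mul_right, ih j (Finset.mem_range.1 hj) k h]; simp

/-- `Φ_n` is orthogonal to every polynomial of degree less than `n`. -/
theorem opInner_monicOP_of_degree_lt {μ : Measure ℂ} [IsFiniteMeasure μ]
    (hμ : μ (Metric.sphere (0 : ℂ) 1)ᶜ = 0)
    (hinf : ∀ s : Finset ℂ, μ (s : Set ℂ)ᶜ ≠ 0) {n : ℕ} {p : ℂ[X]} (hp : p.degree < n) :
    opInner μ (monicOP μ n) p = 0 := by
  have key : ∀ m ≤ n, ∀ p : ℂ[X], p.degree < m → opInner μ (monicOP μ n) p = 0 := by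
    intro m
    induction m with
    | zero =>
      intro _ p hp
      have : p = 0 := by
        rw [← degree_eq_bot]; simpa [Nat.WithBot.lt_zero_iff] using hp
      simp [this, opInner]
    | succ m ih =>
      intro hm p hp
      have h1 := ih (by omega) (p - C (p.coeff m) * monicOP μ m) (by
        rw [degree_lt_iff_coeff_zero] at hp ⊢
        have hd := degree_monicOP μ m
        intro i hi
        rcases hi.eq_or_lt with rfl | hi
        · have hc := degree_monicOP_sub_lt μ m
          rw [degree_lt_iff_coeff_zero] at hc
          have := hc m le_rfl
          rw [coeff_sub, coeff_X_pow_self, sub_eq_zero] at this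
          simp [this]
        · rw [coeff_sub, coeff_C_mul, hp i hi, coeff_eq_zero_of_degree_lt (n := i)
            (by rw [hd]; exact_mod_cast hi)]
          simp)
      rw [opInner_sub_right hμ, opInner_C_mul_right, ← opInner_conj (monicOP μ m),
        opInner_monicOP hμ hinf n m (by omega)] at h1
      simpa using h1
  exact key n le_rfl p hp

theorem coeff_monicOP_self (μ : Measure ℂ) (n : ℕ) : (monicOP μ n).coeff n = 1 := by
  have := (degree_lt_iff_coeff_zero _ _).1 (degree_monicOP_sub_lt μ n) n le_rfl
  rwa [coeff_sub, coeff_X_pow_self, sub_eq_zero] at this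

theorem natDegree_monicOP (μ : Measure ℂ) (n : ℕ) : (monicOP μ n).natDegree = n :=
  natDegree_eq_of_degree_eq_some (degree_monicOP μ n)

theorem revPoly_eval {n : ℕ} {p : ℂ[X]} (hp : p.natDegree ≤ n) {z : ℂ} (hz : ‖z‖ = 1) :
    (revPoly n p).eval z = z ^ n * conj (p.eval z) := by
  have hz0 : z ≠ 0 := by rintro rfl; simp at hz
  have hc : (conj z)⁻¹ = z := by
    rw [Complex.inv_def, Complex.normSq_eq_norm_sq]; simp [hz]
  have hcz : conj z * z = 1 := by rw [← Complex.normSq_eq_conj_mul_self,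
    Complex.normSq_eq_norm_sq, hz]; simp
  have hc0 : conj z ≠ 0 := by simpa using hz0
  let i : Invertible (conj z) := invertibleOfNonzero hc0
  have h := eval₂_reflect_mul_pow (RingHom.id ℂ) (conj z) n (p.map (starRingEnd ℂ))
    ((natDegree_map_le).trans hp)
  rw [invOf_eq_inv, hc] at h
  have h2 : eval₂ (RingHom.id ℂ) (conj z) (p.map (starRingEnd ℂ)) = conj (p.eval z) := by
    rw [eval₂_map, RingHom.id_comp, eval, hom_eval₂, RingHom.comp_id]
  rw [h2] at h
  rw [← h, revPoly, eval, mul_comm, mul_assoc, ← mul_pow, hcz, one_pow, mul_one]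

theorem opInner_congr {μ : Measure ℂ} (hμ : μ (Metric.sphere (0 : ℂ) 1)ᶜ = 0) {p q p' q' : ℂ[X]}
    (h : ∀ z : ℂ, ‖z‖ = 1 → conj (p.eval z) * q.eval z = conj (p'.eval z) * q'.eval z) :
    opInner μ p q = opInner μ p' q' := by
  refine integral_congr_ae ?_
  have : ∀ᵐ z ∂μ, z ∈ Metric.sphere (0 : ℂ) 1 := by rw [ae_iff]; exact hμ
  filter_upwards [this] with z hz
  exact h z (by simpa using hz)

/-- The Szegő recursion `Φ_{n+1} = z Φ_n - conj α_n Φ_n^*`, for every `μ` on the unit circle that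
is not supported on a finite set. -/
theorem szego_recursion {μ : Measure ℂ} [IsFiniteMeasure μ]
    (hμ : μ (Metric.sphere (0 : ℂ) 1)ᶜ = 0)
    (hinf : ∀ s : Finset ℂ, μ (s : Set ℂ)ᶜ ≠ 0) (n : ℕ) :
    monicOP μ (n + 1) =
      X * monicOP μ n - C (conj (verblunsky μ n)) * revPoly n (monicOP μ n) := by
  rw [← sub_eq_zero]
  set R := monicOP μ (n + 1) -
    (X * monicOP μ n - C (conj (verblunsky μ n)) * revPoly n (monicOP μ n)) with hR
  have hrev (i : ℕ) (hi : n < i) (p : ℂ[X]) (hp : p.coeff i = 0) :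
      (revPoly n p).coeff i = 0 := by
    rw [revPoly, coeff_reflect, revAt_eq_self_of_lt hi, coeff_map, hp, map_zero]
  have hcoef (i : ℕ) (hi : n < i) : R.coeff i = 0 := by
    obtain ⟨i, rfl⟩ : ∃ j, i = j + 1 := ⟨i - 1, by omega⟩
    rw [hR, coeff_sub, coeff_sub, coeff_C_mul, coeff_X_mul, hrev _ hi _
      (coeff_eq_zero_of_natDegree_lt (by rw [natDegree_monicOP]; exact hi))]
    rcases (Nat.lt_succ_iff.1 hi).eq_or_lt with rfl | h
    · rw [coeff_monicOP_self, coeff_monicOP_self]; simp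
    · rw [coeff_eq_zero_of_natDegree_lt (by rw [natDegree_monicOP]; omega),
        coeff_eq_zero_of_natDegree_lt (by rw [natDegree_monicOP]; omega)]; simp
  have hR0 : R.coeff 0 = 0 := by
    have h1 : (revPoly n (monicOP μ n)).coeff 0 = 1 := by
      rw [revPoly, coeff_reflect, revAt_le (Nat.zero_le _), coeff_map, Nat.sub_zero,
        coeff_monicOP_self, map_one]
    rw [hR, coeff_sub, coeff_sub, coeff_C_mul, h1, verblunsky, coeff_X_mul_zero,
      ← coeff_zero_eq_eval_zero]
    simp
  have hdeg : R.degree < (n + 1 : ℕ) := (degree_lt_iff_coeff_zero _ _).2 fun i hi => hcoef i hi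
  have hX : X * R.divX = R := by
    conv_rhs => rw [← X_mul_divX_add R, hR0, C_0, add_zero]
  apply eq_zero_of_opInner_self hμ hinf
  have e1 : opInner μ R (monicOP μ (n + 1)) = 0 := by
    rw [← opInner_conj, opInner_monicOP_of_degree_lt hμ hinf hdeg, map_zero]
  have e2 : opInner μ R (X * monicOP μ n) = 0 := by
    have : opInner μ R (X * monicOP μ n) = opInner μ R.divX (monicOP μ n) := by
      refine opInner_congr hμ fun z hz => ?_
      have hcz : conj z * z = 1 := by
        rw [← Complex.normSq_eq_conj_mul_self, Complex.normSq_eq_norm_sq, hz]; simp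
      conv_lhs => rw [← hX]
      simp only [eval_mul, eval_X, map_mul]
      linear_combination (conj (R.divX.eval z) * (monicOP μ n).eval z) * hcz
    rw [this, ← opInner_conj, opInner_monicOP_of_degree_lt hμ hinf, map_zero]
    refine (degree_lt_iff_coeff_zero _ _).2 fun i hi => ?_
    rw [coeff_divX]; exact hcoef _ (by omega)
  have e3 : opInner μ R (revPoly n (monicOP μ n)) = 0 := by
    have : opInner μ R (revPoly n (monicOP μ n)) = opInner μ (monicOP μ n) (revPoly n R) := by
      refine opInner_congr hμ fun z hz => ?_
      rw [revPoly_eval (natDegree_monicOP μ n).le hz,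
        revPoly_eval (natDegree_le_iff_coeff_eq_zero.2 hcoef) hz]
      ring
    rw [this, opInner_monicOP_of_degree_lt hμ hinf]
    refine (degree_lt_iff_coeff_zero _ _).2 fun i hi => ?_
    rcases hi.eq_or_lt with rfl | h
    · rw [revPoly, coeff_reflect, revAt_le le_rfl, Nat.sub_self, coeff_map, hR0, map_zero]
    · exact hrev i h R (hcoef i h)
  conv_lhs => rw [hR]
  rw [← hR, opInner_sub_right hμ, opInner_sub_right hμ, opInner_C_mul_right, e1, e2, e3]
  simp

end recursion

/-- `ρ_n = (1 - |α_n|²)^{1/2}`. -/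
def rho (μ : Measure ℂ) (n : ℕ) : ℝ := Real.sqrt (1 - ‖verblunsky μ n‖ ^ 2)

/-- The logarithmic energy `∬ log (1 / |z - w|) dν(z) dν(w)`, the integral of the positive part
of the integrand (which is `+∞` on the diagonal) minus that of its negative part (which is finite
when `ν` is finite with compact support). -/
def logEnergy (ν : Measure ℂ) : EReal :=
  ((∫⁻ z, ∫⁻ w, (-(ENNReal.log (edist z w))).toENNReal ∂ν ∂ν : ENNReal) : EReal) -
    ((∫⁻ z, ∫⁻ w, (ENNReal.log (edist z w)).toENNReal ∂ν ∂ν : ENNReal) : EReal)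

/-- The logarithmic capacity `C(E) = sup_ν exp (- energy of ν)` of a bounded set `E`, over the
probability measures `ν` with compact support in `E`. -/
def logCapacity (E : Set ℂ) : ℝ :=
  (sSup {c : ENNReal | ∃ ν : Measure ℂ, IsProbabilityMeasure ν ∧
    (∃ K ⊆ E, IsCompact K ∧ ν Kᶜ = 0) ∧ c = EReal.exp (-logEnergy ν)}).toReal

/-- A measure `μ` on the unit circle is regular if `(ρ_1 ⋯ ρ_n)^{1/n} → C(E)` where `E` is the
support of `μ`. -/
def IsRegular (μ : Measure ℂ) : Prop :=
  Tendsto (fun n : ℕ => (∏ j ∈ Finset.Icc 1 n, rho μ j) ^ (1 / (n : ℝ))) atTop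
    (𝓝 (logCapacity μ.support))

end OPUC

end

open MeasureTheory Filter Topology Polynomial ComplexConjugate

noncomputable section

namespace OPUC

/-! The Szegő recursion gives `‖Φ_{n+1}‖² = (1 - |α_n|²) ‖Φ_n‖²` in `L²(μ)`, so `(ρ_1 ⋯ ρ_n)²` is
`‖Φ_{n+1}‖² / ‖Φ_1‖²`. As `ρ_j ≤ 1`, it remains to show that `‖Φ_n‖²` does not decay exponentially
(`exists_log_sqNorm_monicOP_ge`).

Since `Φ_n` is monic, Jensen's formula makes the mean of `log |Φ_n|` over the circle nonnegative.
Split this mean over `A = {w > ε}`, which has almost full measure for small `ε`, and its complement.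
On `A`, concavity of `log` bounds it through `∫_A |Φ_n|² ≤ ‖Φ_n‖² / ε`. Off `A`, the crude bound
`|Φ_n| ≤ 2^n` costs at most `n log 2` times a small measure. Hence `log ‖Φ_n‖² ≥ K - δ n` for every
`δ > 0`.

The capacity of the circle is `1` because energies there are nonnegative: `-log |1 - r z conj w|`
has double integral `∑ r^n |∫ z^n dν|² / n`, and `r → 1` (`lintegral_log_dist_le`). Lebesgue measure
has energy `0`. -/

/-! ### Normalized Lebesgue measure on the circle and the support of `μ`. -/

instance isProbabilityMeasure_angleMeasure : IsProbabilityMeasure angleMeasure := by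
  constructor
  have h : ENNReal.ofReal (2 * Real.pi) ≠ 0 := by
    simpa using Real.pi_pos
  simp only [angleMeasure, Measure.smul_apply, Measure.restrict_apply MeasurableSet.univ,
    Set.univ_inter, Real.volume_Ioc, sub_zero, smul_eq_mul]
  exact ENNReal.inv_mul_cancel h ENNReal.ofReal_ne_top

theorem measurable_circleMap_unit : Measurable (circleMap 0 1) := (continuous_circleMap 0 1).measurable

instance isProbabilityMeasure_circleLebesgue : IsProbabilityMeasure circleLebesgue :=
  Measure.isProbabilityMeasure_map measurable_circleMap_unit.aemeasurable

theorem angleMeasure_absolutelyContinuous : angleMeasure ≪ volume :=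
  (Measure.smul_absolutelyContinuous).trans Measure.restrict_le_self.absolutelyContinuous

theorem circleAverage_eq_integral (f : ℂ → ℝ) :
    Real.circleAverage f 0 1 = ∫ θ, f (circleMap 0 1 θ) ∂angleMeasure := by
  rw [Real.circleAverage, angleMeasure, integral_smul_measure,
    intervalIntegral.integral_of_le (by positivity), ENNReal.toReal_inv,
    ENNReal.toReal_ofReal (by positivity)]

theorem integrable_angleMeasure {f : ℂ → ℝ} (hf : CircleIntegrable f 0 1) :
    Integrable (fun θ => f (circleMap 0 1 θ)) angleMeasure := by
  refine Integrable.smul_measure ?_ (ENNReal.inv_ne_top.2 (by simpa using Real.pi_pos))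
  exact (intervalIntegrable_iff_integrableOn_Ioc_of_le (by positivity)).1 hf

theorem circleLebesgue_of_countable {s : Set ℂ} (hs : s.Countable) : circleLebesgue s = 0 := by
  rw [circleLebesgue, Measure.map_apply measurable_circleMap_unit hs.measurableSet]
  exact angleMeasure_absolutelyContinuous
    ((hs.preimage_circleMap 0 one_ne_zero).measure_zero volume)

theorem circleLebesgue_compl_sphere : circleLebesgue (Metric.sphere (0 : ℂ) 1)ᶜ = 0 := by
  rw [circleLebesgue, Measure.map_apply measurable_circleMap_unit
    Metric.isClosed_sphere.measurableSet.compl]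
  convert measure_empty (μ := angleMeasure)
  ext θ
  simp

theorem sphere_subset_support_circleLebesgue :
    Metric.sphere (0 : ℂ) 1 ⊆ circleLebesgue.support := by
  intro z hz
  rw [Measure.mem_support_iff_forall]
  intro U hU
  obtain ⟨V, hVU, hV, hzV⟩ := mem_nhds_iff.1 hU
  refine lt_of_lt_of_le ?_ (measure_mono hVU)
  rw [circleLebesgue, Measure.map_apply measurable_circleMap_unit hV.measurableSet]
  obtain ⟨θ, hθ, rfl⟩ : z ∈ circleMap 0 1 '' Set.Ioc 0 (2 * Real.pi) := by
    rw [image_circleMap_Ioc]; simpa using hz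
  have hW : IsOpen (circleMap 0 1 ⁻¹' V) := hV.preimage (continuous_circleMap 0 1)
  -- The angle may be the endpoint `2π`, so an open piece of the preimage is sought inside the open
  -- interval, through its closure.
  have hcl : θ ∈ closure (Set.Ioo 0 (2 * Real.pi)) := by
    rw [closure_Ioo (by positivity)]; exact Set.Ioc_subset_Icc_self hθ
  have hne := mem_closure_iff.1 hcl _ hW hzV
  have hp := (hW.inter isOpen_Ioo).measure_pos volume hne
  rw [angleMeasure, Measure.smul_apply, Measure.restrict_apply hW.measurableSet, smul_eq_mul]
  refine ENNReal.mul_pos (ENNReal.inv_ne_zero.2 ENNReal.ofReal_ne_top) (hp.trans_le (measure_mono ?_)).ne'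
  exact Set.inter_subset_inter_right _ Set.Ioo_subset_Ioc_self

/-- A positive density can be inverted. This is how `w > 0` yields both full support and the
nondegeneracy of the inner product on polynomials. -/
theorem circleLebesgue_absolutelyContinuous_acPart {w : ℝ → ℝ} (hw : AEMeasurable w angleMeasure)
    (hpos : ∀ᵐ θ ∂angleMeasure, 0 < w θ) : circleLebesgue ≪ acPart w := by
  refine Measure.AbsolutelyContinuous.map ?_ measurable_circleMap_unit
  refine withDensity_absolutelyContinuous' hw.ennreal_ofReal ?_
  filter_upwards [hpos] with θ hθ
  simpa using hθ

theorem support_eq_sphere {μ : Measure ℂ} (hμ : μ (Metric.sphere (0 : ℂ) 1)ᶜ = 0)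
    (hac : circleLebesgue ≪ μ) : μ.support = Metric.sphere (0 : ℂ) 1 :=
  (Measure.support_subset_of_isClosed Metric.isClosed_sphere hμ).antisymm
    (sphere_subset_support_circleLebesgue.trans hac.support_mono)

theorem compl_finset_ne_zero {μ : Measure ℂ} (hac : circleLebesgue ≪ μ) (s : Finset ℂ) :
    μ (s : Set ℂ)ᶜ ≠ 0 := by
  intro h
  have h1 := hac h
  rw [prob_compl_eq_zero_iff s.measurableSet, circleLebesgue_of_countable s.countable_toSet] at h1
  exact zero_ne_one h1

/-! ### Logarithmic energy and the capacity of the circle. -/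

theorem toENNReal_log_edist (z w : ℂ) :
    (ENNReal.log (edist z w)).toENNReal = ENNReal.ofReal (Real.log (dist z w)) := by
  rcases eq_or_ne z w with rfl | h
  · simp
  · rw [edist_dist, ENNReal.log_ofReal_of_pos (dist_pos.2 h), EReal.toENNReal_of_ne_top (by simp),
      EReal.toReal_coe]

/-- The diagonal must be excluded: there the left side is `⊤`, while `Real.log 0 = 0` makes the
right side `0`. -/
theorem toENNReal_neg_log_edist {z w : ℂ} (h : z ≠ w) :
    (-ENNReal.log (edist z w)).toENNReal = ENNReal.ofReal (-Real.log (dist z w)) := by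
  rw [edist_dist, ENNReal.log_ofReal_of_pos (dist_pos.2 h), ← EReal.coe_neg,
    EReal.toENNReal_of_ne_top (by simp), EReal.toReal_coe]

theorem measurable_toENNReal_neg_log_edist :
    Measurable fun p : ℂ × ℂ => (-ENNReal.log (edist p.1 p.2)).toENNReal := by
  have : Measurable fun p : ℂ × ℂ => edist p.1 p.2 := measurable_edist
  fun_prop

theorem logEnergy_eq_prod (ν : Measure ℂ) [SFinite ν] :
    logEnergy ν =
      ((∫⁻ p, (-(ENNReal.log (edist p.1 p.2))).toENNReal ∂ν.prod ν : ENNReal) : EReal) -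
      ((∫⁻ p, ENNReal.ofReal (Real.log (dist p.1 p.2)) ∂ν.prod ν : ENNReal) : EReal) := by
  have : Measurable fun p : ℂ × ℂ => ENNReal.ofReal (Real.log (dist p.1 p.2)) := by fun_prop
  rw [lintegral_prod _ measurable_toENNReal_neg_log_edist.aemeasurable,
    lintegral_prod _ this.aemeasurable]
  simp only [logEnergy, toENNReal_log_edist]

/-- Distances on the circle are at most `2`. Finiteness of this part keeps the difference defining
the energy from being `⊤ - ⊤`. -/
theorem lintegral_log_dist_lt_top {ν : Measure ℂ} [IsProbabilityMeasure ν]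
    (hν : ∀ᵐ z ∂ν, ‖z‖ = 1) :
    ∫⁻ z, ∫⁻ w, ENNReal.ofReal (Real.log (dist z w)) ∂ν ∂ν < ⊤ := by
  have h : ∫⁻ z, ∫⁻ w, ENNReal.ofReal (Real.log (dist z w)) ∂ν ∂ν ≤
      ∫⁻ _, ∫⁻ _, ENNReal.ofReal 2 ∂ν ∂ν := by
    refine lintegral_mono_ae ?_
    filter_upwards [hν] with z hz
    refine lintegral_mono_ae ?_
    filter_upwards [hν] with w hw
    refine ENNReal.ofReal_le_ofReal ((Real.log_le_self dist_nonneg).trans ?_)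
    calc dist z w ≤ ‖z‖ + ‖w‖ := dist_le_norm_add_norm z w
      _ = 2 := by rw [hz, hw]; norm_num
  refine h.trans_lt ?_
  simp

/-- The logarithmic kernel `-log |1 - r z conj w|` is positive definite on the unit circle. -/
theorem integral_log_norm_one_sub_nonpos {ν : Measure ℂ} [IsProbabilityMeasure ν]
    (hν : ∀ᵐ z ∂ν, ‖z‖ = 1) {r : ℝ} (hr0 : 0 ≤ r) (hr1 : r < 1) :
    ∫ p, Real.log ‖1 - r * p.1 * conj p.2‖ ∂ν.prod ν ≤ 0 := by
  have hν2 : ∀ᵐ p ∂ν.prod ν, ‖(r * p.1 * conj p.2 : ℂ)‖ = r := by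
    have h1 := Measure.quasiMeasurePreserving_fst (μ := ν) (ν := ν) |>.ae hν
    have h2 := Measure.quasiMeasurePreserving_snd (μ := ν) (ν := ν) |>.ae hν
    filter_upwards [h1, h2] with p hp1 hp2
    simp [hp1, hp2, abs_of_nonneg hr0]
  -- Taylor terms of `-log (1 - u)`; the term `n = 0` vanishes because division by zero gives `0`.
  let F : ℕ → ℂ × ℂ → ℂ := fun n p => (r * p.1 * conj p.2) ^ n / n
  have hFm : ∀ n, Measurable (F n) := fun n => by
    have : Continuous (F n) := by simp only [F]; fun_prop
    exact this.measurable
  have hFb : ∀ n, ∀ᵐ p ∂ν.prod ν, ‖F n p‖ ≤ r ^ n := fun n => by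
    filter_upwards [hν2] with p hp
    simp only [F, norm_div, norm_pow, hp, RCLike.norm_natCast]
    rcases Nat.eq_zero_or_pos n with rfl | hn
    · simp
    · exact div_le_self (by positivity) (by exact_mod_cast hn)
  have hFi : ∀ n, Integrable (F n) (ν.prod ν) := fun n =>
    Integrable.of_bound (hFm n).aestronglyMeasurable (r ^ n) (hFb n)
  have hsum : Summable fun n => ∫ p, ‖F n p‖ ∂ν.prod ν := by
    refine Summable.of_nonneg_of_le (fun n => integral_nonneg fun _ => norm_nonneg _)
      (fun n => ?_) (summable_geometric_of_lt_one hr0 hr1)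
    calc ∫ p, ‖F n p‖ ∂ν.prod ν ≤ ∫ _, r ^ n ∂ν.prod ν :=
          integral_mono_ae (hFi n).norm (integrable_const _) (hFb n)
      _ = r ^ n := by simp
  have hG : ∀ᵐ p ∂ν.prod ν, HasSum (fun n => F n p) (-Complex.log (1 - r * p.1 * conj p.2)) := by
    filter_upwards [hν2] with p hp
    exact Complex.hasSum_taylorSeries_neg_log (by rw [hp]; exact hr1)
  have key : HasSum (fun n => ∫ p, F n p ∂ν.prod ν)
      (∫ p, -Complex.log (1 - r * p.1 * conj p.2) ∂ν.prod ν) := by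
    have h := hasSum_integral_of_summable_integral_norm hFi hsum
    rwa [integral_congr_ae (hG.mono fun p hp => hp.tsum_eq)] at h
  -- Each term separates the variables, so its double integral is a moment of `ν` times its own
  -- conjugate.
  have hterm : ∀ n, 0 ≤ (∫ p, F n p ∂ν.prod ν).re := fun n => by
    have e : ∫ p, F n p ∂ν.prod ν = ((r ^ n / n * ‖∫ z, z ^ n ∂ν‖ ^ 2 : ℝ) : ℂ) := by
      have : F n = fun p => (r ^ n / n : ℂ) * (p.1 ^ n * conj (p.2 ^ n)) := by
        ext p; simp only [F, map_pow]; ring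
      rw [this, integral_const_mul, integral_prod_mul (fun z : ℂ => z ^ n) fun z => conj (z ^ n),
        integral_conj, Complex.mul_conj']
      push_cast; rfl
    rw [e, Complex.ofReal_re]
    positivity
  have hre := Complex.hasSum_re key
  have hnn := hre.nonneg hterm
  have hint : Integrable (fun p : ℂ × ℂ => -Complex.log (1 - r * p.1 * conj p.2)) (ν.prod ν) := by
    refine Integrable.of_bound (C := (1 - r)⁻¹) ?_ ?_
    · have : Continuous fun p : ℂ × ℂ => (1 - r * p.1 * conj p.2 : ℂ) := by fun_prop
      exact this.measurable.clog.neg.aestronglyMeasurable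
    · filter_upwards [ae_all_iff.2 hFb, hG] with p hp hp'
      rw [← hp'.tsum_eq]
      exact tsum_of_norm_bounded (hasSum_geometric_of_lt_one hr0 hr1) hp
  have hre' := integral_re hint
  rw [← neg_nonneg, ← integral_neg]
  refine hnn.trans_eq (hre'.symm.trans (integral_congr_ae (Eventually.of_forall fun p => ?_)))
  simp only [RCLike.re_eq_complex_re, Complex.neg_re, Complex.log_re]

/-- Both sides equal `1 - 2 r Re (z conj w) + r²`. In this form, dropping `(1 - r)²` compares the
regularized kernel with the distance. -/
theorem sq_norm_one_sub {z w : ℂ} (hz : ‖z‖ = 1) (hw : ‖w‖ = 1) (r : ℝ) :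
    ‖1 - r * z * conj w‖ ^ 2 = (1 - r) ^ 2 + r * dist z w ^ 2 := by
  have hz' : z.re * z.re + z.im * z.im = 1 := by
    rw [← Complex.normSq_apply, Complex.normSq_eq_norm_sq, hz, one_pow]
  have hw' : w.re * w.re + w.im * w.im = 1 := by
    rw [← Complex.normSq_apply, Complex.normSq_eq_norm_sq, hw, one_pow]
  rw [dist_eq_norm, ← Complex.normSq_eq_norm_sq, ← Complex.normSq_eq_norm_sq, Complex.normSq_apply,
    Complex.normSq_apply]
  simp only [Complex.sub_re, Complex.sub_im, Complex.mul_re, Complex.mul_im, Complex.conj_re,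
    Complex.conj_im, Complex.ofReal_re, Complex.ofReal_im, Complex.one_re, Complex.one_im]
  linear_combination (r ^ 2 * (w.re * w.re + w.im * w.im) - r) * hz' + (r ^ 2 - r) * hw'

/-- This is nonnegativity of the energy, written without subtraction so that infinite energy needs
no separate treatment. The regularized kernel dominates `log dist` up to `-(log r) / 2` and has
nonpositive integral; the error vanishes as `r → 1`. -/
theorem lintegral_log_dist_le {ν : Measure ℂ} [IsProbabilityMeasure ν]
    (hν : ∀ᵐ z ∂ν, ‖z‖ = 1) :
    ∫⁻ p, ENNReal.ofReal (Real.log (dist p.1 p.2)) ∂ν.prod ν ≤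
      ∫⁻ p, (-(ENNReal.log (edist p.1 p.2))).toENNReal ∂ν.prod ν := by
  set A := ∫⁻ p, (-(ENNReal.log (edist p.1 p.2))).toENNReal ∂ν.prod ν
  set B := ∫⁻ p, ENNReal.ofReal (Real.log (dist p.1 p.2)) ∂ν.prod ν
  have h1 := Measure.quasiMeasurePreserving_fst (μ := ν) (ν := ν) |>.ae hν
  have h2 := Measure.quasiMeasurePreserving_snd (μ := ν) (ν := ν) |>.ae hν
  have main : ∀ r : ℝ, 0 < r → r < 1 → B ≤ A + ENNReal.ofReal (-(Real.log r / 2)) := by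
    intro r hr0 hr1
    -- Adding `M` makes `f` nonnegative, so that the comparison can be integrated in `ENNReal`; `M`
    -- is finite and cancels at the end.
    set M := -Real.log (1 - r) with hM
    set c := -(Real.log r / 2) with hc
    have hc0 : 0 ≤ c := by have := Real.log_nonpos hr0.le hr1.le; rw [hc]; linarith
    have hM0 : 0 ≤ M := by
      have := Real.log_nonpos (x := 1 - r) (by linarith) (by linarith); rw [hM]; linarith
    set f : ℂ × ℂ → ℝ := fun p => Real.log ‖1 - r * p.1 * conj p.2‖ with hf
    have hfm : Measurable f := by
      have : Continuous fun p : ℂ × ℂ => ‖(1 - r * p.1 * conj p.2 : ℂ)‖ := by fun_prop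
      exact this.measurable.log
    have hn : ∀ᵐ p ∂ν.prod ν, 1 - r ≤ ‖(1 - r * p.1 * conj p.2 : ℂ)‖ ∧
        ‖(1 - r * p.1 * conj p.2 : ℂ)‖ ≤ 2 := by
      filter_upwards [h1, h2] with p hp1 hp2
      have hu : ‖(r * p.1 * conj p.2 : ℂ)‖ = r := by simp [hp1, hp2, abs_of_pos hr0]
      constructor
      · have := norm_sub_norm_le (1 : ℂ) (r * p.1 * conj p.2); rwa [hu, norm_one] at this
      · have := norm_sub_le (1 : ℂ) (r * p.1 * conj p.2); rw [hu, norm_one] at this; linarith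
    have hfM : ∀ᵐ p ∂ν.prod ν, -M ≤ f p := by
      filter_upwards [hn] with p hp
      rw [hM, neg_neg]; exact Real.log_le_log (by linarith) hp.1
    have hfi : Integrable f (ν.prod ν) := by
      refine Integrable.of_bound hfm.aestronglyMeasurable (M + 2) ?_
      filter_upwards [hn, hfM] with p hp hp'
      rw [Real.norm_eq_abs, abs_le]
      refine ⟨by linarith, ?_⟩
      have := Real.log_le_self (norm_nonneg (1 - r * p.1 * conj p.2 : ℂ))
      simp only [hf]; linarith [hp.2]
    have hpt : ∀ᵐ p ∂ν.prod ν, ENNReal.ofReal (Real.log (dist p.1 p.2)) + ENNReal.ofReal M ≤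
        (-(ENNReal.log (edist p.1 p.2))).toENNReal + ENNReal.ofReal (f p + M + c) := by
      filter_upwards [h1, h2, hfM] with p hp1 hp2 hp3
      rcases eq_or_ne p.1 p.2 with h | h
      -- On the diagonal the right side is `⊤`.
      · simp [h]
      have hd := dist_pos.2 h
      have hle : Real.log (dist p.1 p.2) ≤ f p + c := by
        have hsq := sq_norm_one_sub hp1 hp2 r
        have h3 : r * dist p.1 p.2 ^ 2 ≤ ‖1 - r * p.1 * conj p.2‖ ^ 2 := by
          rw [hsq]; nlinarith [sq_nonneg (1 - r)]
        have h4 := Real.log_le_log (by positivity) h3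
        rw [Real.log_mul hr0.ne' (by positivity), Real.log_pow, Real.log_pow] at h4
        push_cast at h4
        simp only [hf, hc]; linarith
      rw [toENNReal_neg_log_edist h]
      rcases le_total 0 (Real.log (dist p.1 p.2)) with h0 | h0
      · rw [← ENNReal.ofReal_add h0 hM0]
        exact (ENNReal.ofReal_le_ofReal (by linarith)).trans le_add_self
      · rw [ENNReal.ofReal_of_nonpos h0, zero_add, ← ENNReal.ofReal_add (by linarith)
          (by linarith)]
        have h5 : -Real.log (dist p.1 p.2) + f p + c ≥ 0 := by linarith
        exact ENNReal.ofReal_le_ofReal (by linarith)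
    have hB := lintegral_mono_ae hpt
    rw [lintegral_add_right _ measurable_const,
      lintegral_add_left measurable_toENNReal_neg_log_edist] at hB
    have hi2 : Integrable (fun p => f p + M + c) (ν.prod ν) :=
      (hfi.add (integrable_const M)).add (integrable_const c)
    have hlast : ∫⁻ p, ENNReal.ofReal (f p + M + c) ∂ν.prod ν ≤
        ENNReal.ofReal c + ENNReal.ofReal M := by
      rw [← ofReal_integral_eq_lintegral_ofReal hi2 (by
        filter_upwards [hfM] with p hp; simp only [Pi.zero_apply]; linarith),
        ← ENNReal.ofReal_add hc0 hM0]
      refine ENNReal.ofReal_le_ofReal ?_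
      have hfM' : Integrable (fun p => f p + M) (ν.prod ν) := hfi.add (integrable_const M)
      rw [integral_add hfM' (integrable_const c), integral_add hfi (integrable_const M)]
      have := integral_log_norm_one_sub_nonpos hν hr0.le hr1
      simp only [integral_const, probReal_univ, one_smul]
      linarith
    have hfin := hB.trans (add_le_add_right hlast A)
    rw [lintegral_const, measure_univ, mul_one, ← add_assoc] at hfin
    exact (ENNReal.add_le_add_iff_right ENNReal.ofReal_ne_top).1 hfin
  have hlim : Tendsto (fun r : ℝ => A + ENNReal.ofReal (-(Real.log r / 2))) (𝓝[<] 1) (𝓝 A) := by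
    have hl : Tendsto (fun r : ℝ => -(Real.log r / 2)) (𝓝[<] 1) (𝓝 0) := by
      have : ContinuousAt (fun r : ℝ => -(Real.log r / 2)) 1 :=
        ((Real.continuousAt_log one_ne_zero).div_const 2).neg
      have h := this.tendsto.mono_left (nhdsWithin_le_nhds (s := Set.Iio 1))
      simpa using h
    have h := (ENNReal.tendsto_ofReal hl).const_add A
    simpa using h
  refine ge_of_tendsto hlim ?_
  filter_upwards [Ioo_mem_nhdsLT (zero_lt_one' ℝ)] with r hr
  exact main r hr.1 hr.2

theorem logEnergy_nonneg {ν : Measure ℂ} [IsProbabilityMeasure ν] (hν : ∀ᵐ z ∂ν, ‖z‖ = 1) :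
    0 ≤ logEnergy ν := by
  have hfin := lintegral_log_dist_lt_top hν
  have hm : Measurable fun p : ℂ × ℂ => ENNReal.ofReal (Real.log (dist p.1 p.2)) := by fun_prop
  rw [← lintegral_prod (fun p : ℂ × ℂ => ENNReal.ofReal (Real.log (dist p.1 p.2)))
    hm.aemeasurable] at hfin
  rw [logEnergy_eq_prod, EReal.sub_nonneg (Or.inr (by simpa using hfin.ne)) (Or.inr (by simp))]
  exact EReal.coe_ennreal_le_coe_ennreal_iff.2 (lintegral_log_dist_le hν)

theorem ae_norm_eq_one {ν : Measure ℂ} (hν : ν (Metric.sphere (0 : ℂ) 1)ᶜ = 0) :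
    ∀ᵐ z ∂ν, ‖z‖ = 1 := by
  have h : ∀ᵐ z ∂ν, z ∈ Metric.sphere (0 : ℂ) 1 := by rw [ae_iff]; exact hν
  filter_upwards [h] with z hz
  simpa using hz

/-- The mean of `log |z - w|` over the unit circle in `w` is `log⁺ |z|`, which is `0` here: the
logarithmic potential of Lebesgue measure vanishes on the circle. -/
theorem lintegral_neg_log_dist_circleLebesgue {z : ℂ} (hz : ‖z‖ = 1) :
    ∫⁻ w, (-(ENNReal.log (edist z w))).toENNReal ∂circleLebesgue =
      ∫⁻ w, ENNReal.ofReal (Real.log (dist z w)) ∂circleLebesgue := by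
  have hne : ∀ᵐ w ∂circleLebesgue, z ≠ w := by
    rw [ae_iff]
    exact measure_mono_null (fun w hw => by simpa [eq_comm] using hw)
      (circleLebesgue_of_countable (Set.countable_singleton z))
  have e1 : ∫⁻ w, (-(ENNReal.log (edist z w))).toENNReal ∂circleLebesgue =
      ∫⁻ w, ENNReal.ofReal (-Real.log (dist z w)) ∂circleLebesgue :=
    lintegral_congr_ae (hne.mono fun w hw => toENNReal_neg_log_edist hw)
  have hi : CircleIntegrable (fun w => Real.log (dist z w)) 0 1 := by
    have : CircleIntegrable (fun w => Real.log ‖w - z‖) 0 1 := by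
      refine MeromorphicOn.circleIntegrable_log_norm ?_
      intro w _
      fun_prop
    simpa only [dist_eq_norm, norm_sub_rev z] using this
  have hm : Measurable fun w => Real.log (dist z w) := (by fun_prop : Measurable (dist z)).log
  have hint : Integrable (fun w => Real.log (dist z w)) circleLebesgue := by
    rw [circleLebesgue, integrable_map_measure hm.aestronglyMeasurable
      measurable_circleMap_unit.aemeasurable]
    exact integrable_angleMeasure hi
  have hzero : ∫ w, Real.log (dist z w) ∂circleLebesgue = 0 := by
    rw [circleLebesgue, integral_map measurable_circleMap_unit.aemeasurable hm.aestronglyMeasurable,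
      ← circleAverage_eq_integral (fun w => Real.log (dist z w))]
    have := circleAverage_log_norm_sub_const_eq_log_radius_add_posLog (a := z) (c := 0)
      (R := 1) one_ne_zero
    simpa only [dist_eq_norm, norm_sub_rev z, hz, Real.log_one, inv_one, one_mul, zero_sub,
      norm_neg, Real.posLog_one, add_zero] using this
  rw [integral_eq_lintegral_pos_part_sub_lintegral_neg_part hint, sub_eq_zero,
    ENNReal.toReal_eq_toReal_iff' hint.lintegral_lt_top.ne
      (by simpa using hint.neg.lintegral_lt_top.ne)] at hzero
  rw [e1, hzero]

theorem logEnergy_circleLebesgue : logEnergy circleLebesgue = 0 := by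
  have hν := ae_norm_eq_one circleLebesgue_compl_sphere
  have hfin := lintegral_log_dist_lt_top hν
  simp only [logEnergy, toENNReal_log_edist]
  rw [lintegral_congr_ae (hν.mono fun z hz => lintegral_neg_log_dist_circleLebesgue hz)]
  exact EReal.sub_self (by simpa using hfin.ne) (by simp)

theorem logCapacity_sphere : logCapacity (Metric.sphere (0 : ℂ) 1) = 1 := by
  rw [logCapacity, ← ENNReal.toReal_one]
  congr 1
  refine le_antisymm (sSup_le ?_) (le_sSup ?_)
  · rintro _ ⟨ν, hν, ⟨K, hK, -, hνK⟩, rfl⟩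
    rw [EReal.exp_le_one_iff, EReal.neg_le_zero]
    exact logEnergy_nonneg (ae_norm_eq_one (measure_mono_null (Set.compl_subset_compl.2 hK) hνK))
  · exact ⟨circleLebesgue, inferInstance,
      ⟨_, subset_rfl, isCompact_sphere _ _, circleLebesgue_compl_sphere⟩,
      by rw [logEnergy_circleLebesgue]; simp⟩

/-! ### Norms of the monic orthogonal polynomials. -/

/-- The squared `L²(μ)` norm of a polynomial. -/
def sqNorm (μ : Measure ℂ) (p : ℂ[X]) : ℝ := ∫ z, ‖p.eval z‖ ^ 2 ∂μ

theorem opInner_self_eq_sqNorm (μ : Measure ℂ) (p : ℂ[X]) : opInner μ p p = (sqNorm μ p : ℂ) := by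
  rw [opInner, sqNorm, ← integral_complex_ofReal]
  congr 1
  ext z
  rw [Complex.conj_mul']
  norm_cast

theorem sqNorm_nonneg (μ : Measure ℂ) (p : ℂ[X]) : 0 ≤ sqNorm μ p :=
  integral_nonneg fun _ => by positivity

variable {μ : Measure ℂ} [IsFiniteMeasure μ]

theorem sqNorm_monicOP_pos (hμ : μ (Metric.sphere (0 : ℂ) 1)ᶜ = 0)
    (hinf : ∀ s : Finset ℂ, μ (s : Set ℂ)ᶜ ≠ 0) (n : ℕ) : 0 < sqNorm μ (monicOP μ n) := by
  refine (sqNorm_nonneg μ _).lt_of_ne' fun h => ?_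
  have h0 := eq_zero_of_opInner_self hμ hinf (p := monicOP μ n)
    (by rw [opInner_self_eq_sqNorm, h, Complex.ofReal_zero])
  have := degree_monicOP μ n
  rw [h0] at this
  simp at this

theorem degree_revPoly_monicOP_lt (μ : Measure ℂ) (n : ℕ) :
    (revPoly n (monicOP μ n)).degree < (n + 1 : ℕ) := by
  refine (degree_lt_iff_coeff_zero _ _).2 fun i hi => ?_
  rw [revPoly, coeff_reflect, revAt_eq_self_of_lt (by omega), coeff_map,
    coeff_eq_zero_of_natDegree_lt (by rw [natDegree_monicOP]; omega), map_zero]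

/-- On the circle, `z Φ_n` and `Φ_n^*` have the norm of `Φ_n`. Since `Φ_{n+1}` is orthogonal to
`Φ_n^*`, the recursion is an orthogonal decomposition of `z Φ_n`, and Pythagoras applies. -/
theorem sqNorm_monicOP_succ (hμ : μ (Metric.sphere (0 : ℂ) 1)ᶜ = 0)
    (hinf : ∀ s : Finset ℂ, μ (s : Set ℂ)ᶜ ≠ 0) (n : ℕ) :
    sqNorm μ (monicOP μ (n + 1)) = (1 - ‖verblunsky μ n‖ ^ 2) * sqNorm μ (monicOP μ n) := by
  have hz1 : ∀ z : ℂ, ‖z‖ = 1 → conj z * z = 1 := fun z hz => by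
    rw [← Complex.normSq_eq_conj_mul_self, Complex.normSq_eq_norm_sq, hz]; simp
  set a := verblunsky μ n
  set P := monicOP μ n with hP
  set S := revPoly n P with hS
  have hrec : monicOP μ (n + 1) = X * P - C (conj a) * S := szego_recursion hμ hinf n
  have hXX : opInner μ (X * P) (X * P) = opInner μ P P := by
    refine opInner_congr hμ fun z hz => ?_
    simp only [eval_mul, eval_X, map_mul]
    linear_combination (conj (P.eval z) * P.eval z) * hz1 z hz
  have hSS : opInner μ S S = opInner μ P P := by
    refine opInner_congr hμ fun z hz => ?_
    have hpow : conj z ^ n * z ^ n = 1 := by rw [← mul_pow, hz1 z hz, one_pow]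
    rw [hS, revPoly_eval (natDegree_monicOP μ n).le hz]
    simp only [map_mul, map_pow, Complex.conj_conj]
    linear_combination (conj (P.eval z) * P.eval z) * hpow
  have hS0 : opInner μ (monicOP μ (n + 1)) S = 0 :=
    opInner_monicOP_of_degree_lt hμ hinf (degree_revPoly_monicOP_lt μ n)
  have h1 : opInner μ S (X * P) = conj a * opInner μ P P := by
    have h := congrArg conj hS0
    rw [opInner_conj, map_zero, hrec, opInner_sub_right hμ, opInner_C_mul_right, hSS] at h
    linear_combination h
  have h2 : opInner μ (monicOP μ (n + 1)) (monicOP μ (n + 1)) =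
      opInner μ (monicOP μ (n + 1)) (X * P) := by
    have h := congrArg (opInner μ (monicOP μ (n + 1))) hrec
    rwa [opInner_sub_right hμ, opInner_C_mul_right, hS0, mul_zero, sub_zero] at h
  have h3 : opInner μ (X * P) (monicOP μ (n + 1)) = (1 - conj a * a) * opInner μ P P := by
    rw [hrec, opInner_sub_right hμ, opInner_C_mul_right, hXX, ← opInner_conj S (X * P), h1,
      map_mul, Complex.conj_conj, opInner_conj]
    ring
  rw [← opInner_conj (X * P), h3, opInner_self_eq_sqNorm, opInner_self_eq_sqNorm,
    Complex.conj_mul'] at h2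
  have h4 : ((sqNorm μ (monicOP μ (n + 1)) : ℝ) : ℂ) =
      ((1 - ‖a‖ ^ 2) * sqNorm μ P : ℝ) := by
    rw [h2]
    simp
  exact_mod_cast h4

theorem norm_verblunsky_lt_one (hμ : μ (Metric.sphere (0 : ℂ) 1)ᶜ = 0)
    (hinf : ∀ s : Finset ℂ, μ (s : Set ℂ)ᶜ ≠ 0) (n : ℕ) : ‖verblunsky μ n‖ < 1 := by
  have h := sqNorm_monicOP_pos hμ hinf (n + 1)
  rw [sqNorm_monicOP_succ hμ hinf] at h
  have h1 := pos_of_mul_pos_left h (sqNorm_nonneg μ _)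
  nlinarith [norm_nonneg (verblunsky μ n)]

/-- Each recursion step at most doubles the bound, since `|Φ_n^*| = |Φ_n|` on the circle and `|α_n|
< 1`. Any exponential bound would serve, as it is only used on a set of small measure. -/
theorem norm_eval_monicOP_le (hμ : μ (Metric.sphere (0 : ℂ) 1)ᶜ = 0)
    (hinf : ∀ s : Finset ℂ, μ (s : Set ℂ)ᶜ ≠ 0) {z : ℂ} (hz : ‖z‖ = 1) (n : ℕ) :
    ‖(monicOP μ n).eval z‖ ≤ 2 ^ n := by
  induction n with
  | zero => rw [monicOP_eq]; simp
  | succ n ih =>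
    rw [szego_recursion hμ hinf, eval_sub, eval_mul, eval_mul, eval_X, eval_C,
      revPoly_eval (natDegree_monicOP μ n).le hz]
    refine (norm_sub_le _ _).trans ?_
    simp only [norm_mul, norm_pow, hz, RCLike.norm_conj, one_pow, one_mul]
    have h1 := norm_verblunsky_lt_one hμ hinf n
    have h2 := norm_nonneg ((monicOP μ n).eval z)
    rw [pow_succ]
    nlinarith

theorem rho_sq (hμ : μ (Metric.sphere (0 : ℂ) 1)ᶜ = 0)
    (hinf : ∀ s : Finset ℂ, μ (s : Set ℂ)ᶜ ≠ 0) (n : ℕ) :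
    rho μ n ^ 2 = 1 - ‖verblunsky μ n‖ ^ 2 := by
  refine Real.sq_sqrt ?_
  nlinarith [norm_verblunsky_lt_one hμ hinf n, norm_nonneg (verblunsky μ n)]

theorem rho_le_one (μ : Measure ℂ) (n : ℕ) : rho μ n ≤ 1 :=
  Real.sqrt_le_one.2 (by nlinarith [sq_nonneg ‖verblunsky μ n‖])

theorem rho_pos (hμ : μ (Metric.sphere (0 : ℂ) 1)ᶜ = 0)
    (hinf : ∀ s : Finset ℂ, μ (s : Set ℂ)ᶜ ≠ 0) (n : ℕ) : 0 < rho μ n := by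
  refine Real.sqrt_pos.2 ?_
  nlinarith [norm_verblunsky_lt_one hμ hinf n, norm_nonneg (verblunsky μ n)]

/-- The norm recursion telescopes. As the product omits `ρ_0`, the constant left over is `‖Φ_1‖²`.
-/
theorem sqNorm_monicOP_eq_prod (hμ : μ (Metric.sphere (0 : ℂ) 1)ᶜ = 0)
    (hinf : ∀ s : Finset ℂ, μ (s : Set ℂ)ᶜ ≠ 0) (n : ℕ) :
    sqNorm μ (monicOP μ (n + 1)) =
      (∏ j ∈ Finset.Icc 1 n, rho μ j) ^ 2 * sqNorm μ (monicOP μ 1) := by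
  induction n with
  | zero => simp
  | succ n ih =>
    rw [sqNorm_monicOP_succ hμ hinf, ih, Finset.prod_Icc_succ_top (by omega), mul_pow,
      rho_sq hμ hinf]
    ring

/-! ### Subexponential lower bound for the norms. -/

theorem setIntegral_sq_le_sqNorm (hμ : μ (Metric.sphere (0 : ℂ) 1)ᶜ = 0) {w : ℝ → ℝ}
    (hw : Measurable w) (hle : acPart w ≤ μ) (p : ℂ[X]) {ε : ℝ} (hε : 0 ≤ ε) :
    ε * ∫ θ in {θ | ε < w θ}, ‖p.eval (circleMap 0 1 θ)‖ ^ 2 ∂angleMeasure ≤ sqNorm μ p := by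
  have hA : MeasurableSet {θ | ε < w θ} := measurableSet_lt measurable_const hw
  have hc : Continuous fun z : ℂ => ‖p.eval z‖ ^ 2 := by fun_prop
  have hcc : Continuous fun θ => ‖p.eval (circleMap 0 1 θ)‖ ^ 2 :=
    hc.comp (continuous_circleMap 0 1)
  have hg : Measurable fun z : ℂ => ENNReal.ofReal (‖p.eval z‖ ^ 2) := hc.measurable.ennreal_ofReal
  have hgc : Measurable fun θ => ENNReal.ofReal (‖p.eval (circleMap 0 1 θ)‖ ^ 2) :=
    hg.comp measurable_circleMap_unit
  have hfin : ∫⁻ z, ENNReal.ofReal (‖p.eval z‖ ^ 2) ∂μ < ⊤ := by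
    have hi := integrable_of_circle hμ (Complex.continuous_ofReal.comp hc)
    exact Integrable.lintegral_lt_top hi.re
  rw [sqNorm, integral_eq_lintegral_of_nonneg_ae (Eventually.of_forall fun _ => by positivity)
    hc.aestronglyMeasurable, integral_eq_lintegral_of_nonneg_ae
    (Eventually.of_forall fun _ => by positivity) hcc.aestronglyMeasurable,
    ← ENNReal.toReal_ofReal hε, ← ENNReal.toReal_mul, ENNReal.toReal_ofReal hε]
  refine ENNReal.toReal_mono hfin.ne ?_
  calc ENNReal.ofReal ε * ∫⁻ θ in {θ | ε < w θ},
        ENNReal.ofReal (‖p.eval (circleMap 0 1 θ)‖ ^ 2) ∂angleMeasure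
      = ∫⁻ θ in {θ | ε < w θ}, ENNReal.ofReal ε *
          ENNReal.ofReal (‖p.eval (circleMap 0 1 θ)‖ ^ 2) ∂angleMeasure :=
        (lintegral_const_mul _ hgc).symm
    _ ≤ ∫⁻ θ in {θ | ε < w θ}, ENNReal.ofReal (w θ) *
          ENNReal.ofReal (‖p.eval (circleMap 0 1 θ)‖ ^ 2) ∂angleMeasure := by
        refine setLIntegral_mono' hA fun θ hθ => ?_
        gcongr
        exact le_of_lt hθ
    _ ≤ ∫⁻ θ, ENNReal.ofReal (w θ) *
          ENNReal.ofReal (‖p.eval (circleMap 0 1 θ)‖ ^ 2) ∂angleMeasure :=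
        setLIntegral_le_lintegral _ _
    _ = ∫⁻ z, ENNReal.ofReal (‖p.eval z‖ ^ 2) ∂acPart w := by
        rw [acPart, lintegral_map hg measurable_circleMap_unit,
          lintegral_withDensity_eq_lintegral_mul _ hw.ennreal_ofReal hgc]
        rfl
    _ ≤ ∫⁻ z, ENNReal.ofReal (‖p.eval z‖ ^ 2) ∂μ := lintegral_mono' hle le_rfl

/-- By Jensen's formula the integral is `log` of the leading coefficient's modulus plus the sum of
`log⁺ |root|`. -/
theorem integral_log_norm_nonneg_of_monic {p : ℂ[X]} (hp : p.Monic) :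
    0 ≤ ∫ θ, Real.log ‖p.eval (circleMap 0 1 θ)‖ ∂angleMeasure := by
  rw [← circleAverage_eq_integral fun z => Real.log ‖p.eval z‖, ← logMahlerMeasure_def,
    logMahlerMeasure_eq_log_leadingCoeff_add_sum_log_roots, hp.leadingCoeff]
  simp only [norm_one, Real.log_one, zero_add]
  refine Multiset.sum_nonneg fun x hx => ?_
  obtain ⟨a, -, rfl⟩ := Multiset.mem_map.1 hx
  exact Real.posLog_nonneg

theorem ae_eval_circleMap_ne_zero {p : ℂ[X]} (hp : p ≠ 0) :
    ∀ᵐ θ ∂angleMeasure, p.eval (circleMap 0 1 θ) ≠ 0 := by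
  have h : (circleMap 0 1 ⁻¹' (p.roots.toFinset : Set ℂ)).Countable :=
    p.roots.toFinset.countable_toSet.preimage_circleMap 0 one_ne_zero
  rw [ae_iff]
  refine measure_mono_null (fun θ hθ => ?_)
    (angleMeasure_absolutelyContinuous (h.measure_zero volume))
  simpa [hp] using hθ

/-- A Jensen-type inequality: a monic polynomial which is at most `M` on the circle cannot have
small mean square on a set of angles of almost full measure. -/
theorem zero_le_of_monic_of_bound {p : ℂ[X]} (hp : p.Monic) {M : ℝ} (hM : 1 ≤ M)
    (hb : ∀ z : ℂ, ‖z‖ = 1 → ‖p.eval z‖ ≤ M) {A : Set ℝ} (hA : MeasurableSet A) {c : ℝ} (hc : 0 < c)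
    (hint : ∫ θ in A, ‖p.eval (circleMap 0 1 θ)‖ ^ 2 ∂angleMeasure ≤ c) :
    0 ≤ 1 + angleMeasure.real A * (Real.log c - 1) +
      (1 - angleMeasure.real A) * (2 * Real.log M) := by
  have hlogM := Real.log_nonneg hM
  have hi : Integrable (fun θ => Real.log ‖p.eval (circleMap 0 1 θ)‖) angleMeasure :=
    integrable_angleMeasure (f := fun z => Real.log ‖p.eval z‖) p.intervalIntegrable_mahlerMeasure
  have hsq : Integrable (fun θ => ‖p.eval (circleMap 0 1 θ)‖ ^ 2) angleMeasure := by
    have : Continuous fun θ => ‖p.eval (circleMap 0 1 θ)‖ ^ 2 :=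
      (p.continuous.comp (continuous_circleMap 0 1)).norm.pow 2
    refine Integrable.of_bound this.aestronglyMeasurable (M ^ 2) (Eventually.of_forall fun θ => ?_)
    rw [Real.norm_of_nonneg (by positivity)]
    gcongr
    exact hb _ (by simp)
  have hne := ae_eval_circleMap_ne_zero hp.ne_zero
  have h0 := integral_log_norm_nonneg_of_monic hp
  rw [← integral_add_compl hA hi] at h0
  have hin : 2 * ∫ θ in A, Real.log ‖p.eval (circleMap 0 1 θ)‖ ∂angleMeasure ≤
      1 + angleMeasure.real A * (Real.log c - 1) := by
    rw [← integral_const_mul]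
    calc ∫ θ in A, 2 * Real.log ‖p.eval (circleMap 0 1 θ)‖ ∂angleMeasure
        ≤ ∫ θ in A, (c⁻¹ * ‖p.eval (circleMap 0 1 θ)‖ ^ 2 + (Real.log c - 1)) ∂angleMeasure := by
          refine integral_mono_ae (hi.integrableOn.const_mul 2)
            ((hsq.integrableOn.const_mul c⁻¹).add (integrable_const _)) (ae_restrict_of_ae ?_)
          filter_upwards [hne] with θ hθ
          have hpos : 0 < ‖p.eval (circleMap 0 1 θ)‖ ^ 2 := by positivity
          -- The tangent-line bound `log x ≤ x - 1` at `x = |p|² / c` stands in for Jensen's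
          -- inequality, at the cost of an additive constant.
          have h1 := Real.log_le_sub_one_of_pos (mul_pos (inv_pos.2 hc) hpos)
          rw [Real.log_mul (by positivity) hpos.ne', Real.log_inv, Real.log_pow] at h1
          push_cast at h1
          linarith
      _ = c⁻¹ * ∫ θ in A, ‖p.eval (circleMap 0 1 θ)‖ ^ 2 ∂angleMeasure +
            angleMeasure.real A * (Real.log c - 1) := by
          rw [integral_add (hsq.integrableOn.const_mul c⁻¹) (integrable_const _),
            integral_const_mul, setIntegral_const, smul_eq_mul]
      _ ≤ 1 + angleMeasure.real A * (Real.log c - 1) := by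
          gcongr
          rw [inv_mul_le_iff₀ hc, mul_one]
          exact hint
  have hout : ∫ θ in Aᶜ, Real.log ‖p.eval (circleMap 0 1 θ)‖ ∂angleMeasure ≤
      (1 - angleMeasure.real A) * Real.log M := by
    calc ∫ θ in Aᶜ, Real.log ‖p.eval (circleMap 0 1 θ)‖ ∂angleMeasure
        ≤ ∫ _ in Aᶜ, Real.log M ∂angleMeasure := by
          refine integral_mono_ae hi.integrableOn (integrable_const _) (ae_restrict_of_ae ?_)
          filter_upwards [hne] with θ hθ
          exact Real.log_le_log (norm_pos_iff.2 hθ) (hb _ (by simp))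
      _ = (1 - angleMeasure.real A) * Real.log M := by
          rw [setIntegral_const, smul_eq_mul, probReal_compl_eq_one_sub hA]
  linarith

/-- Continuity from below: the sets `{w > 1/(k+1)}` increase to a set of full measure. -/
theorem exists_measureReal_setOf_lt {w : ℝ → ℝ} (hpos : ∀ᵐ θ ∂angleMeasure, 0 < w θ) {δ : ℝ} (hδ : 0 < δ) :
    ∃ ε > 0, 1 - δ < angleMeasure.real {θ | ε < w θ} := by
  have hmono : Monotone fun k : ℕ => {θ | 1 / ((k : ℝ) + 1) < w θ} := fun i j hij θ hθ =>
    show 1 / ((j : ℝ) + 1) < w θ from (Nat.one_div_le_one_div hij).trans_lt hθ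
  have hU : angleMeasure (⋃ k : ℕ, {θ | 1 / ((k : ℝ) + 1) < w θ}) = 1 := by
    rw [← measure_univ (μ := angleMeasure)]
    refine measure_congr ?_
    rw [eventuallyEq_univ]
    filter_upwards [hpos] with θ hθ
    exact Set.mem_iUnion.2 (exists_nat_one_div_lt hθ)
  have ht := tendsto_measure_iUnion_atTop (μ := angleMeasure) hmono
  rw [hU] at ht
  have ht' := (ENNReal.tendsto_toReal ENNReal.one_ne_top).comp ht
  rw [ENNReal.toReal_one] at ht'
  obtain ⟨k, hk⟩ := (ht'.eventually (lt_mem_nhds (sub_lt_self 1 hδ))).exists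
  exact ⟨1 / ((k : ℝ) + 1), by positivity, hk⟩

theorem exists_log_sqNorm_monicOP_ge (hμ : μ (Metric.sphere (0 : ℂ) 1)ᶜ = 0)
    (hinf : ∀ s : Finset ℂ, μ (s : Set ℂ)ᶜ ≠ 0) {w : ℝ → ℝ} (hw : Measurable w)
    (hle : acPart w ≤ μ) (hpos : ∀ᵐ θ ∂angleMeasure, 0 < w θ) {δ : ℝ} (hδ : 0 < δ) :
    ∃ K : ℝ, ∀ n : ℕ, K - δ * n ≤ Real.log (sqNorm μ (monicOP μ n)) := by
  -- The bound `δ / 4` keeps the contribution off `A`, at most `2 (1 - a) n log 2`, below `δ n / 2`.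
  -- The bound `1 / 2` ensures that a negative quantity multiplied by `a` is at most half of itself.
  obtain ⟨ε, hε, ha⟩ := exists_measureReal_setOf_lt hpos
    (lt_min (show 0 < δ / 4 by linarith) (one_half_pos (α := ℝ)))
  set A := {θ | ε < w θ}
  set a := angleMeasure.real A
  have ha1 : 1 - a < δ / 4 := by have := min_le_left (δ / 4) (1 / 2); linarith
  have ha2 : 1 / 2 < a := by have := min_le_right (δ / 4) ((1 : ℝ) / 2); linarith
  refine ⟨Real.log ε - 1, fun n => ?_⟩
  set N := sqNorm μ (monicOP μ n)
  have hN : 0 < N := sqNorm_monicOP_pos hμ hinf n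
  have hJ := zero_le_of_monic_of_bound (p := monicOP μ n) (M := 2 ^ n)
    (by rw [Monic, leadingCoeff, natDegree_monicOP, coeff_monicOP_self])
    (one_le_pow₀ one_le_two) (fun z hz => norm_eval_monicOP_le hμ hinf hz n)
    (measurableSet_lt measurable_const hw : MeasurableSet A) (div_pos hN hε)
    (by rw [le_div_iff₀ hε, mul_comm]; exact setIntegral_sq_le_sqNorm hμ hw hle _ hε.le)
  rw [Real.log_div hN.ne' hε.ne', Real.log_pow] at hJ
  have hlog2 : Real.log 2 ≤ 1 := by linarith [Real.log_le_sub_one_of_pos (zero_lt_two' ℝ)]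
  have hlog0 : 0 ≤ Real.log 2 := Real.log_nonneg one_le_two
  have hn : (0 : ℝ) ≤ n := n.cast_nonneg
  have hnl : (n : ℝ) * Real.log 2 ≤ n := mul_le_of_le_one_right hn hlog2
  have hout : (1 - a) * (2 * (n * Real.log 2)) ≤ δ / 2 * n := by
    calc (1 - a) * (2 * (n * Real.log 2)) ≤ δ / 4 * (2 * (n * Real.log 2)) := by gcongr
      _ ≤ δ / 4 * (2 * n) := by gcongr
      _ = δ / 2 * n := by ring
  by_contra! hlt
  have hδn : 0 ≤ δ * n := by positivity
  -- The constant `K = log ε - 1` is chosen for this: half of `-2 - δ n` exactly offsets the `1` and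
  -- the `δ n / 2` in `hJ`.
  have hx : Real.log N - Real.log ε - 1 < -2 - δ * n := by linarith
  have h2 : a * (Real.log N - Real.log ε - 1) ≤ 1 / 2 * (Real.log N - Real.log ε - 1) :=
    mul_le_mul_of_nonpos_right ha2.le (by linarith)
  linarith

/-! ### Passage to the `n`-th root and conclusion. -/

theorem tendsto_div_nat_of_lower_bounds {L : ℕ → ℝ} (hL : ∀ n, L n ≤ 0)
    (h : ∀ δ > 0, ∃ K : ℝ, ∀ n : ℕ, K - δ * n ≤ L n) :
    Tendsto (fun n : ℕ => L n * (1 / (n : ℝ))) atTop (𝓝 0) := by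
  rw [tendsto_order]
  constructor
  · intro b hb
    -- Half of the margin `b` absorbs `δ`, the other half absorbs `K / n`.
    obtain ⟨K, hK⟩ := h (-b / 2) (by linarith)
    have ht : Tendsto (fun n : ℕ => K / (n : ℝ)) atTop (𝓝 0) := tendsto_const_div_atTop_nhds_zero_nat K
    filter_upwards [ht.eventually (lt_mem_nhds (show b / 2 < 0 by linarith)),
      eventually_gt_atTop 0] with n hn hn0
    have hn0' : (0 : ℝ) < n := by exact_mod_cast hn0
    rw [mul_one_div, lt_div_iff₀ hn0']
    rw [lt_div_iff₀ hn0'] at hn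
    have := hK n
    linarith
  · intro b hb
    refine Eventually.of_forall fun n => lt_of_le_of_lt ?_ hb
    exact mul_nonpos_of_nonpos_of_nonneg (hL n) (by positivity)

theorem tendsto_prod_rho (hμ : μ (Metric.sphere (0 : ℂ) 1)ᶜ = 0)
    (hinf : ∀ s : Finset ℂ, μ (s : Set ℂ)ᶜ ≠ 0) {w : ℝ → ℝ} (hw : Measurable w)
    (hle : acPart w ≤ μ) (hpos : ∀ᵐ θ ∂angleMeasure, 0 < w θ) :
    Tendsto (fun n : ℕ => (∏ j ∈ Finset.Icc 1 n, rho μ j) ^ (1 / (n : ℝ))) atTop (𝓝 1) := by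
  have hP : ∀ n : ℕ, 0 < ∏ j ∈ Finset.Icc 1 n, rho μ j := fun n =>
    Finset.prod_pos fun j _ => rho_pos hμ hinf j
  have hlim : Tendsto (fun n : ℕ => Real.log (∏ j ∈ Finset.Icc 1 n, rho μ j) * (1 / (n : ℝ)))
      atTop (𝓝 0) := by
    refine tendsto_div_nat_of_lower_bounds (fun n => Real.log_nonpos (hP n).le
      (Finset.prod_le_one (fun j _ => (rho_pos hμ hinf j).le) fun j _ => rho_le_one μ j)) ?_
    intro δ hδ
    obtain ⟨K, hK⟩ := exists_log_sqNorm_monicOP_ge hμ hinf hw hle hpos hδ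
    -- The extra `δ` comes from using the bound at `n + 1`; the division by `2` comes from the
    -- squared product.
    refine ⟨(K - δ - Real.log (sqNorm μ (monicOP μ 1))) / 2, fun n => ?_⟩
    have h := hK (n + 1)
    rw [sqNorm_monicOP_eq_prod hμ hinf, Real.log_mul (pow_ne_zero 2 (hP n).ne')
      (sqNorm_monicOP_pos hμ hinf 1).ne', Real.log_pow] at h
    push_cast at h
    have hδn : 0 ≤ δ * n := by positivity
    linarith
  have hexp := (Real.continuous_exp.tendsto 0).comp hlim
  rw [Real.exp_zero] at hexp
  refine hexp.congr fun n => ?_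
  rw [Function.comp_apply, ← Real.rpow_def_of_pos (hP n)]

theorem acPart_congr {w w' : ℝ → ℝ} (h : w =ᵐ[angleMeasure] w') : acPart w = acPart w' := by
  exact congrArg (Measure.map (circleMap 0 1)) (withDensity_congr_ae (h.fun_comp ENNReal.ofReal))

end OPUC

end

/-- If `dμ = w(θ) dθ/2π + dμ_s` on the unit circle, with `μ_s` Lebesgue singular and `w > 0`
almost everywhere, then `μ` is regular, its support being the whole unit circle, whose
logarithmic capacity is `1`. -/
theorem theorem3p1 (μ μs : MeasureTheory.Measure ℂ) [MeasureTheory.IsFiniteMeasure μ]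
    (hμ : μ (Metric.sphere (0 : ℂ) 1)ᶜ = 0)
    (w : ℝ → ℝ) (hw : AEMeasurable w OPUC.angleMeasure)
    (hdecomp : μ = OPUC.acPart w + μs)
    (hs : MeasureTheory.Measure.MutuallySingular μs OPUC.circleLebesgue)
    (hpos : ∀ᵐ θ ∂OPUC.angleMeasure, 0 < w θ) :
    μ.support = Metric.sphere (0 : ℂ) 1 ∧
      OPUC.logCapacity (Metric.sphere (0 : ℂ) 1) = 1 ∧
      OPUC.IsRegular μ ∧
      Filter.Tendsto
        (fun n : ℕ => (∏ j ∈ Finset.Icc 1 n, OPUC.rho μ j) ^ (1 / (n : ℝ)))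
        Filter.atTop (nhds 1) := by
  have hle : OPUC.acPart w ≤ μ := hdecomp ▸ MeasureTheory.Measure.le_add_right le_rfl
  have hac := (OPUC.circleLebesgue_absolutelyContinuous_acPart hw hpos).trans
    hle.absolutelyContinuous
  have hsupp := OPUC.support_eq_sphere hμ hac
  -- A measurable representative of `w` leaves `acPart` unchanged and makes the sets `{w > ε}`
  -- measurable.
  have hlim := OPUC.tendsto_prod_rho hμ (OPUC.compl_finset_ne_zero hac) hw.measurable_mk
    ((OPUC.acPart_congr hw.ae_eq_mk).symm.trans_le hle)
    (by filter_upwards [hpos, hw.ae_eq_mk] with θ h1 h2; rwa [← h2])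
  refine ⟨hsupp, OPUC.logCapacity_sphere, ?_, hlim⟩
  rw [OPUC.IsRegular, hsupp, OPUC.logCapacity_sphere]
  exact hlim
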